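/- Let $F$ be a probability distribution on $\mathbb{R}$ with mean $\mu$ and finite variance $\sigma^2 \ge 0$, let $x_1, x_2, \ldots$ be independent random variables with distribution $F$, and let $X \sim F$. Let $(\alpha_n)$ be any real sequence with $\lim_{n\to\infty}\alpha_n = \infty$. For each $n$ let $$\rho_n(x) = \begin{cases} x^2/2, & |x| < \alpha_n,\\ \alpha_n |x| - \alpha_n^2/2, & |x| \ge \alpha_n,\end{cases}$$ be the Huber loss with parameter $\alpha_n$, let $\psi_n = \rho_n'$ be its derivative, and let $\lambda_n(t) = E\,\psi_n(X - t)$. Then for all sufficiently large $n$ the equation $\lambda_n(t) = 0$ has exactly one solution $t \in \mathbb{R}$. Let $t_n$ be real numbers with $\lambda_n(t_n) = 0$ for all sufficiently large $n$, and let $T_n$ be real random variables such that, for all sufficiently large $n$, almost surely $\sum_{i=1}^n \psi_n(x_i - T_n) = 0$. Then, as $n \to \infty$, $$\sqrt{n}\,(T_n - t_n) \xrightarrow{d} N(0, \sigma^2),$$ where $N(0,0)$ is the point mass at $0$. Moreover, $$\frac{t_n - \mu}{E\,\psi_n(X - \mu)} \to 1 ,$$ in the sense that this ratio tends to $1$ as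 $n \to \infty$ along the indices $n$ with $E\,\psi_n(X-\mu) \ne 0$, while $t_n = \mu$ for all sufficiently large $n$ with $E\,\psi_n(X-\mu) = 0$. -/

import Mathlib

open MeasureTheory ProbabilityTheory Filter Topology
open scoped NNReal

noncomputable section

/-- The Huber loss with parameter `α`: quadratic on `|x| < α`, linear outside. -/
def huberLoss (α x : ℝ) : ℝ :=
  if |x| < α then x ^ 2 / 2 else α * |x| - α ^ 2 / 2

/-- The Huber score: the derivative of the Huber loss (which is `C¹` for `0 < α`). -/
def huberScore (α x : ℝ) : ℝ :=
  deriv (huberLoss α) x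

/-- The expected score `E ψ(X - t)` for `X` with law `F`. -/
def expectedScore (F : Measure ℝ) (α t : ℝ) : ℝ :=
  ∫ x, huberScore α (x - t) ∂F

end

/-!
For `0 < α` the Huber score is the clamp `max (-α) (min α x)`. Hence a mean score, whether the
population mean `t ↦ E ψ(X - t)` or the empirical mean `t ↦ n⁻¹ ∑ ψ(xᵢ - t)`, is nonincreasing and
`1`-Lipschitz in `t`. On `[c - 1, c + 1]` its slope differs from `-1` by at most the proportion `p`
of points at distance more than `α - 1` from `c`, because all other points stay in the linear range
of the score. The structure `NearUnitSlope` records these three facts, and everything else about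
zeros follows from it: if `p ≤ 1 / 2` and `|G c| < 1 / 2`, then `G` has exactly one zero `z`, and
`|z - c - G c| ≤ 2 * p * |G c|` (`NearUnitSlope.abs_zero_sub_le`).

For the population score centred at `c = μ`, both `p` and `G μ = E ψₙ(X - μ)` tend to `0`. This
gives the unique zero, and the displayed inequality is the claim on the bias.

For the empirical score centred at `c = tₙ`, multiplying the inequality by `√n` gives
`|√n (Tₙ - tₙ) - W| ≤ 2 p |W|` with `W = n^(-1/2) ∑ ψₙ(xᵢ - tₙ)`, outside an event whose probability
tends to `0`. The right-hand side tends to `0` in probability, since `E W²` is bounded and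
`E p → 0`. Finally the summands of `W - n^(-1/2) ∑ (xᵢ - μ)` are independent and centred, and their
second moment tends to `0` by dominated convergence. So `√n (Tₙ - tₙ)` differs from the normalized
sum of the classical central limit theorem by a term that tends to `0` in probability
(`measureReal_mestimator_sub_le`).
-/

/-! ### The Huber score as a clamp -/

/-- The three regimes of the Huber loss, each with the value of the clamp `max (-α) (min α x)`. The
boundary points may be put in either neighbouring regime since the formulas agree there. -/
theorem huberLoss_regimes {α : ℝ} (hα : 0 < α) (x : ℝ) :
    (x ≤ -α ∧ max (-α) (min α x) = -α ∧ huberLoss α x = -α * x - α ^ 2 / 2) ∨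
    (-α ≤ x ∧ x ≤ α ∧ max (-α) (min α x) = x ∧ huberLoss α x = x ^ 2 / 2) ∨
    (α ≤ x ∧ max (-α) (min α x) = α ∧ huberLoss α x = α * x - α ^ 2 / 2) := by
  unfold huberLoss
  rcases le_or_gt x (-α) with h | h
  · left
    rw [min_eq_right (by linarith), max_eq_left h, abs_of_nonpos (by linarith),
      if_neg (by linarith)]
    exact ⟨h, rfl, by ring⟩
  rcases lt_or_ge x α with h' | h'
  · right; left
    rw [min_eq_right h'.le, max_eq_right h.le, if_pos (abs_lt.2 ⟨h, h'⟩)]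
    exact ⟨h.le, h'.le, rfl, rfl⟩
  · right; right
    rw [min_eq_left h', max_eq_right (by linarith), abs_of_nonneg (by linarith),
      if_neg (by linarith)]
    exact ⟨h', rfl, rfl⟩

theorem huberScore_eq {α : ℝ} (hα : 0 < α) (x : ℝ) :
    huberScore α x = max (-α) (min α x) := by
  -- A quadratic remainder bound gives the derivative at all points, the two kinks of the clamp
  -- included.
  have key : ∀ y, |huberLoss α y - huberLoss α x - (y - x) * max (-α) (min α x)|
      ≤ (y - x) ^ 2 := by
    intro y
    rw [abs_le]
    rcases huberLoss_regimes hα x with ⟨hx, e1, e2⟩ | ⟨hx, hx', e1, e2⟩ | ⟨hx, e1, e2⟩ <;>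
      rcases huberLoss_regimes hα y with ⟨hy, -, e3⟩ | ⟨hy, hy', -, e3⟩ | ⟨hy, -, e3⟩ <;>
      rw [e1, e2, e3] <;> constructor <;> nlinarith [sq_nonneg (y - x), sq_nonneg (y + α),
        sq_nonneg (y - α), sq_nonneg (x + α), sq_nonneg (x - α)]
  refine HasDerivAt.deriv ?_
  rw [hasDerivAt_iff_isLittleO]
  refine (Asymptotics.IsBigO.of_bound 1 (.of_forall fun y => ?_)).trans_isLittleO
    (Asymptotics.isLittleO_pow_sub_sub x one_lt_two)
  simpa using key y

theorem huberScore_sub_nonneg {α : ℝ} (hα : 0 < α) (x : ℝ) {s t : ℝ} (hst : s ≤ t) :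
    0 ≤ huberScore α (x - s) - huberScore α (x - t) := by
  rw [huberScore_eq hα, huberScore_eq hα, sub_nonneg]
  gcongr

theorem huberScore_sub_le {α : ℝ} (hα : 0 < α) (x : ℝ) {s t : ℝ} (hst : s ≤ t) :
    huberScore α (x - s) - huberScore α (x - t) ≤ t - s := by
  rw [huberScore_eq hα, huberScore_eq hα]
  rcases max_cases (-α) (min α (x - s)) with h | h <;>
    rcases max_cases (-α) (min α (x - t)) with h' | h' <;>
    rcases min_cases α (x - s) with h2 | h2 <;>
    rcases min_cases α (x - t) with h3 | h3 <;> linarith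

theorem huberScore_of_abs_le {α : ℝ} (hα : 0 < α) {x : ℝ} (hx : |x| ≤ α) :
    huberScore α x = x := by
  rw [huberScore_eq hα, min_eq_right (abs_le.1 hx).2, max_eq_right (abs_le.1 hx).1]

theorem abs_huberScore_le_abs {α : ℝ} (hα : 0 < α) (x : ℝ) : |huberScore α x| ≤ |x| := by
  rw [huberScore_eq hα]
  rcases max_cases (-α) (min α x) with h | h <;> rcases min_cases α x with h2 | h2 <;>
    rcases abs_cases x with h3 | h3 <;> rw [abs_le] <;> constructor <;> linarith

theorem measurable_huberScore_sub (α t : ℝ) : Measurable fun y => huberScore α (y - t) :=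
  (measurable_deriv (huberLoss α)).comp (measurable_id.sub_const t)

/-- A point `x` within `α - 1` of `c` remains in the linear range of the score when the location
moves inside `[c - 1, c + 1]`, so its score then has slope exactly `-1`. -/
theorem le_huberScore_sub {α : ℝ} (hα : 0 < α) (x c : ℝ) {s t : ℝ} (hst : s ≤ t)
    (hs : c - 1 ≤ s) (ht : t ≤ c + 1) :
    (1 - {y | α - 1 < |y - c|}.indicator 1 x) * (t - s)
      ≤ huberScore α (x - s) - huberScore α (x - t) := by
  by_cases h : α - 1 < |x - c|
  · simpa [Set.indicator, h] using huberScore_sub_nonneg hα x hst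
  · have h' := abs_le.1 (not_lt.1 h)
    rw [huberScore_of_abs_le hα (abs_le.2 ⟨by linarith, by linarith⟩),
      huberScore_of_abs_le hα (abs_le.2 ⟨by linarith, by linarith⟩)]
    simp [Set.indicator, h]

/-! ### Functions of slope almost `-1` -/

/-- `G` is nonincreasing and `1`-Lipschitz, and its slope is at most `-(1 - p)` on
`[c - 1, c + 1]`. -/
structure NearUnitSlope (G : ℝ → ℝ) (c p : ℝ) : Prop where
  anti : Antitone G
  upper : ∀ ⦃s t⦄, s ≤ t → G s - G t ≤ t - s
  lower : ∀ ⦃s t⦄, s ≤ t → c - 1 ≤ s → t ≤ c + 1 → (1 - p) * (t - s) ≤ G s - G t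

namespace NearUnitSlope

variable {G : ℝ → ℝ} {c p z : ℝ}

theorem continuous (h : NearUnitSlope G c p) : Continuous G := by
  refine (LipschitzWith.of_dist_le_mul (K := 1) fun s t => ?_).continuous
  rw [Real.dist_eq, Real.dist_eq, NNReal.coe_one, one_mul]
  rcases le_total s t with hst | hst
  · rw [abs_of_nonneg (sub_nonneg.2 (h.anti hst)), abs_sub_comm, abs_of_nonneg (sub_nonneg.2 hst)]
    exact h.upper hst
  · rw [abs_sub_comm, abs_of_nonneg (sub_nonneg.2 (h.anti hst)), abs_of_nonneg (sub_nonneg.2 hst)]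
    exact h.upper hst

theorem apply_add_one_neg (h : NearUnitSlope G c p) (hp : p ≤ 1 / 2) (hG : |G c| < 1 / 2) :
    G (c + 1) < 0 := by
  have := h.lower (s := c) (t := c + 1) (by linarith) (by linarith) le_rfl
  linarith [(abs_lt.1 hG).2]

theorem apply_sub_one_pos (h : NearUnitSlope G c p) (hp : p ≤ 1 / 2) (hG : |G c| < 1 / 2) :
    0 < G (c - 1) := by
  have := h.lower (s := c - 1) (t := c) (by linarith) le_rfl (by linarith)
  linarith [(abs_lt.1 hG).1]

theorem sub_one_le (h : NearUnitSlope G c p) (hp : p ≤ 1 / 2) (hG : |G c| < 1 / 2)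
    (hz : G z = 0) : c - 1 ≤ z := by
  by_contra! hlt
  linarith [h.apply_sub_one_pos hp hG, h.anti hlt.le]

theorem le_add_one (h : NearUnitSlope G c p) (hp : p ≤ 1 / 2) (hG : |G c| < 1 / 2)
    (hz : G z = 0) : z ≤ c + 1 := by
  by_contra! hlt
  linarith [h.apply_add_one_neg hp hG, h.anti hlt.le]

theorem existsUnique_zero (h : NearUnitSlope G c p) (hp : p ≤ 1 / 2) (hG : |G c| < 1 / 2) :
    ∃! z, G z = 0 := by
  obtain ⟨z, -, hz⟩ := intermediate_value_Icc' (show c - 1 ≤ c + 1 by linarith)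
    h.continuous.continuousOn
    ⟨(h.apply_add_one_neg hp hG).le, (h.apply_sub_one_pos hp hG).le⟩
  have key : ∀ a b, G a = 0 → G b = 0 → a ≤ b → b ≤ a := fun a b ha hb hab => by
    have := h.lower hab (h.sub_one_le hp hG ha) (h.le_add_one hp hG hb)
    nlinarith
  refine ⟨z, hz, fun y hy => ?_⟩
  rcases le_total y z with hyz | hyz
  · exact le_antisymm hyz (key _ _ hy hz hyz)
  · exact le_antisymm (key _ _ hz hy hyz) hyz

/-- One Newton step with slope `-1` from `c` finds the zero up to a relative error `2 * p`. -/
theorem abs_zero_sub_le (h : NearUnitSlope G c p) (hp0 : 0 ≤ p) (hp : p ≤ 1 / 2)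
    (hG : |G c| < 1 / 2) (hz : G z = 0) : |z - c - G c| ≤ 2 * p * |G c| := by
  have hz1 := h.sub_one_le hp hG hz
  have hz2 := h.le_add_one hp hG hz
  rcases le_total c z with hcz | hcz
  · have h1 := h.upper hcz
    have h2 := h.lower hcz (by linarith) hz2
    rw [abs_of_nonneg (by linarith), abs_of_nonneg (by nlinarith)]
    nlinarith [mul_nonneg hp0 (sub_nonneg.2 hcz)]
  · have h1 := h.upper hcz
    have h2 := h.lower hcz hz1 (by linarith)
    rw [abs_of_nonpos (by linarith), abs_of_nonpos (by nlinarith)]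
    nlinarith [mul_nonneg hp0 (sub_nonneg.2 hcz)]

end NearUnitSlope

/-! ### Mean scores -/

theorem integrable_huberScore {F : Measure ℝ} [IsProbabilityMeasure F] {α : ℝ} (hα : 0 < α)
    (t : ℝ) : Integrable (fun y => huberScore α (y - t)) F := by
  refine .of_bound (measurable_huberScore_sub α t).aestronglyMeasurable α (.of_forall fun y => ?_)
  rw [huberScore_eq hα, Real.norm_eq_abs, abs_le]
  exact ⟨le_max_left _ _, max_le (by linarith) (min_le_left _ _)⟩

theorem measurableSet_lt_abs_sub (a c : ℝ) : MeasurableSet {y : ℝ | a < |y - c|} :=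
  measurableSet_lt (by fun_prop) (by fun_prop)

theorem nearUnitSlope_expectedScore {F : Measure ℝ} [IsProbabilityMeasure F] {α : ℝ}
    (hα : 0 < α) (c : ℝ) :
    NearUnitSlope (expectedScore F α) c (F.real {y | α - 1 < |y - c|}) where
  anti s t hst := integral_mono (integrable_huberScore hα _) (integrable_huberScore hα _)
    fun y => sub_nonneg.1 (huberScore_sub_nonneg hα y hst)
  upper s t hst := by
    unfold expectedScore
    rw [← integral_sub (integrable_huberScore hα _) (integrable_huberScore hα _)]
    simpa using integral_mono
      ((integrable_huberScore (F := F) hα s).sub (integrable_huberScore hα t))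
      (integrable_const (t - s)) fun y => huberScore_sub_le hα y hst
  lower s t hst hs ht := by
    unfold expectedScore
    have hI : Integrable ({y | α - 1 < |y - c|}.indicator (1 : ℝ → ℝ)) F :=
      (integrable_const (1 : ℝ)).indicator (measurableSet_lt_abs_sub _ _)
    rw [← integral_sub (integrable_huberScore hα _) (integrable_huberScore hα _)]
    have := integral_mono (((integrable_const (1 : ℝ)).sub hI).mul_const (t - s))
      ((integrable_huberScore (F := F) hα s).sub (integrable_huberScore hα t))
      fun y => le_huberScore_sub hα y c hst hs ht
    simp only [Pi.sub_apply] at this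
    rwa [integral_mul_const, integral_sub (integrable_const _) hI,
      integral_indicator_one (measurableSet_lt_abs_sub _ _), integral_const, probReal_univ,
      one_smul] at this

theorem nearUnitSlope_average {α : ℝ} (hα : 0 < α) (c : ℝ) {n : ℕ} (hn : 0 < n) (x : ℕ → ℝ) :
    NearUnitSlope (fun t => (n : ℝ)⁻¹ * ∑ i ∈ Finset.range n, huberScore α (x i - t)) c
      ((n : ℝ)⁻¹ * ∑ i ∈ Finset.range n, {y | α - 1 < |y - c|}.indicator 1 (x i)) where
  anti s t hst := by
    dsimp only
    gcongr with i
    exact sub_nonneg.1 (huberScore_sub_nonneg hα _ hst)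
  upper s t hst := by
    rw [← mul_sub, ← Finset.sum_sub_distrib, inv_mul_le_iff₀ (by positivity)]
    refine (Finset.sum_le_sum fun i _ => huberScore_sub_le hα (x i) hst).trans_eq ?_
    simp [mul_sub]
  lower s t hst hs ht := by
    rw [← mul_sub, ← Finset.sum_sub_distrib, le_inv_mul_iff₀ (by positivity)]
    refine le_trans (le_of_eq ?_)
      (Finset.sum_le_sum fun i _ => le_huberScore_sub hα (x i) c hst hs ht)
    rw [← Finset.sum_mul, Finset.sum_sub_distrib]
    have : (n : ℝ) ≠ 0 := by positivity
    simp
    field_simp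

/-! ### The estimator and the normalized sum -/

section Sample

variable {Ω : Type*} [MeasurableSpace Ω] {P : Measure Ω} {F : Measure ℝ} {x : ℕ → Ω → ℝ}

theorem memLp_comp_of_hasLaw {X : Ω → ℝ} (hX : HasLaw X F P) {g : ℝ → ℝ} (hg : MemLp g 2 F) :
    MemLp (fun ω => g (X ω)) 2 P := by
  rw [← hX.map_eq] at hg
  exact hg.comp_of_map hX.aemeasurable

theorem memLp_normalized_sum (hlaw : ∀ i, HasLaw (x i) F P) {g : ℝ → ℝ} (hg : MemLp g 2 F)
    (n : ℕ) : MemLp (fun ω => (√(n : ℝ))⁻¹ * ∑ i ∈ Finset.range n, g (x i ω)) 2 P :=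
  (memLp_finsetSum _ fun i _ => memLp_comp_of_hasLaw (hlaw i) hg).const_mul _

theorem integral_sq_normalized_sum [IsProbabilityMeasure P]
    (hlaw : ∀ i, HasLaw (x i) F P) (hindep : iIndepFun x P)
    {g : ℝ → ℝ} (hgm : Measurable g) (hg : MemLp g 2 F) (hg0 : ∫ y, g y ∂F = 0) {n : ℕ}
    (hn : 0 < n) :
    ∫ ω, ((√(n : ℝ))⁻¹ * ∑ i ∈ Finset.range n, g (x i ω)) ^ 2 ∂P = ∫ y, g y ^ 2 ∂F := by
  have hL i : MemLp (fun ω => g (x i ω)) 2 P := memLp_comp_of_hasLaw (hlaw i) hg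
  have h0 i : ∫ ω, g (x i ω) ∂P = 0 := by
    rw [← hg0]; exact (hlaw i).integral_comp hgm.aestronglyMeasurable
  have hv i : Var[fun ω => g (x i ω); P] = ∫ y, g y ^ 2 ∂F := by
    rw [variance_of_integral_eq_zero (hL i).aemeasurable (h0 i)]
    exact (hlaw i).integral_comp (f := fun y => g y ^ 2) (hgm.pow_const 2).aestronglyMeasurable
  have hsum := IndepFun.variance_sum (X := fun i ω => g (x i ω)) (s := Finset.range n) (μ := P)
    (fun i _ => hL i)
    (fun i _ j _ hij => (hindep.indepFun hij).comp hgm hgm)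
  have hS0 : ∫ ω, (∑ i ∈ Finset.range n, fun ω => g (x i ω)) ω ∂P = 0 := by
    simp only [Finset.sum_apply]
    rw [integral_finsetSum _ fun i _ => (hL i).integrable one_le_two]
    simp [h0]
  rw [variance_of_integral_eq_zero (memLp_finsetSum' _ fun i _ => hL i).aemeasurable hS0] at hsum
  simp only [hv, Finset.sum_apply, Finset.sum_const, Finset.card_range, nsmul_eq_mul] at hsum
  simp_rw [mul_pow, integral_const_mul]
  rw [hsum, inv_pow, Real.sq_sqrt (by positivity), inv_mul_cancel_left₀ (by positivity)]

theorem integral_average_indicator [IsProbabilityMeasure P]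
    (hlaw : ∀ i, HasLaw (x i) F P) {s : Set ℝ}
    (hs : MeasurableSet s) {n : ℕ} (hn : 0 < n) :
    Integrable (fun ω => (n : ℝ)⁻¹ * ∑ i ∈ Finset.range n, s.indicator 1 (x i ω)) P ∧
    ∫ ω, (n : ℝ)⁻¹ * ∑ i ∈ Finset.range n, s.indicator 1 (x i ω) ∂P = F.real s := by
  have hm : Measurable (s.indicator (1 : ℝ → ℝ)) := measurable_one.indicator hs
  have hI i : Integrable (fun ω => s.indicator (1 : ℝ → ℝ) (x i ω)) P := by
    refine .of_bound (hm.comp_aemeasurable (hlaw i).aemeasurable).aestronglyMeasurable 1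
      (.of_forall fun ω => ?_)
    by_cases h : x i ω ∈ s <;> simp [h]
  refine ⟨(integrable_finsetSum _ fun i _ => hI i).const_mul _, ?_⟩
  rw [integral_const_mul, integral_finsetSum _ fun i _ => hI i]
  have h1 i : ∫ ω, s.indicator (1 : ℝ → ℝ) (x i ω) ∂P = F.real s := by
    rw [← integral_indicator_one hs]
    exact (hlaw i).integral_comp hm.aestronglyMeasurable
  simp only [h1, Finset.sum_const, Finset.card_range, nsmul_eq_mul]
  rw [inv_mul_cancel_left₀ (by positivity)]

theorem measureReal_ge_le_integral_div {f : Ω → ℝ} (hf : Integrable f P) (h0 : ∀ ω, 0 ≤ f ω)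
    {a : ℝ} (ha : 0 < a) : P.real {ω | a ≤ f ω} ≤ (∫ ω, f ω ∂P) / a := by
  rw [le_div_iff₀ ha, mul_comm]
  exact mul_meas_ge_le_integral_of_nonneg (.of_forall h0) hf a

/-- Nonasymptotic bound for the distance between the normalized M-estimator and the normalized sum
of the sample. The four terms bound the probabilities that the proportion of far points exceeds
`1 / 2`, that the score at `c` is too large to confine the zero to `[c - 1, c + 1]`, that the error
of the linearization exceeds `ε / 2`, and that truncating the summands costs more than `ε / 2`. -/
theorem measureReal_mestimator_sub_le [IsProbabilityMeasure P] [IsProbabilityMeasure F]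
    {μ α c δ M ε : ℝ} (hF : MemLp (fun y : ℝ => y) 2 F)
    (hμ : ∫ y, y ∂F = μ) (hlaw : ∀ i, HasLaw (x i) F P) (hindep : iIndepFun x P)
    (hα : 0 < α) (hc : expectedScore F α c = 0)
    (hM : ∫ y, huberScore α (y - c) ^ 2 ∂F ≤ M)
    (hδ : 0 < δ) (hq : F.real {y | α - 1 < |y - c|} ≤ δ ^ 2) (hε : 0 < ε)
    {n : ℕ} (hn : 0 < n) {T : Ω → ℝ}
    (hT : ∀ᵐ ω ∂P, ∑ i ∈ Finset.range n, huberScore α (x i ω - T ω) = 0) :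
    P.real {ω | ε ≤ |√(n : ℝ) * (T ω - c)
        - (√(n : ℝ))⁻¹ * (∑ i ∈ Finset.range n, x i ω - n * μ)|}
      ≤ 2 * δ ^ 2 + 4 * M / n + 2 * δ * (M + 1) / ε
        + 4 * (∫ y, (huberScore α (y - c) - (y - μ)) ^ 2 ∂F) / ε ^ 2 := by
  have hnR : (0 : ℝ) < n := by positivity
  have hsq : 0 < √(n : ℝ) := Real.sqrt_pos.2 hnR
  have hsq2 : √(n : ℝ) ^ 2 = n := Real.sq_sqrt hnR.le
  have hgm := measurable_huberScore_sub α c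
  have hgL : MemLp (fun y => huberScore α (y - c)) 2 F :=
    MemLp.mono (hF.sub (memLp_const c)) hgm.aestronglyMeasurable
      (.of_forall fun y => abs_huberScore_le_abs hα _)
  have hDL : MemLp (fun y => huberScore α (y - c) - (y - μ)) 2 F :=
    hgL.sub (hF.sub (memLp_const μ))
  have hDm : Measurable fun y => huberScore α (y - c) - (y - μ) := by fun_prop
  have hD0 : ∫ y, huberScore α (y - c) - (y - μ) ∂F = 0 := by
    have hi := hF.integrable one_le_two
    have hi' : Integrable (fun y => y - μ) F := hi.sub (integrable_const μ)
    rw [integral_sub (integrable_huberScore hα c) hi',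
      integral_sub hi (integrable_const μ), hμ]
    unfold expectedScore at hc
    simp [hc]
  set W : Ω → ℝ := fun ω => (√(n : ℝ))⁻¹ * ∑ i ∈ Finset.range n, huberScore α (x i ω - c) with hW
  set D : Ω → ℝ := fun ω =>
    (√(n : ℝ))⁻¹ * ∑ i ∈ Finset.range n, (huberScore α (x i ω - c) - (x i ω - μ)) with hD
  set p : Ω → ℝ := fun ω =>
    (n : ℝ)⁻¹ * ∑ i ∈ Finset.range n, {y | α - 1 < |y - c|}.indicator 1 (x i ω) with hp
  have hWI : Integrable (fun ω => W ω ^ 2) P := (memLp_normalized_sum hlaw hgL n).integrable_sq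
  have hDI : Integrable (fun ω => D ω ^ 2) P := (memLp_normalized_sum hlaw hDL n).integrable_sq
  obtain ⟨hpI, hpE⟩ := integral_average_indicator hlaw (measurableSet_lt_abs_sub (α - 1) c) hn
  have hWE : ∫ ω, W ω ^ 2 ∂P ≤ M :=
    (integral_sq_normalized_sum hlaw hindep hgm hgL hc hn).trans_le hM
  have hDE := integral_sq_normalized_sum hlaw hindep hDm hDL hD0 hn
  have hp0 : ∀ ω, 0 ≤ p ω := fun ω => mul_nonneg (by positivity)
    (Finset.sum_nonneg fun i _ => Set.indicator_nonneg (fun _ _ => zero_le_one) _)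
  have hsub : {ω | ε ≤ |√(n : ℝ) * (T ω - c)
        - (√(n : ℝ))⁻¹ * (∑ i ∈ Finset.range n, x i ω - n * μ)|} ≤ᵐ[P]
      ((({ω | 1 / 2 ≤ p ω} ∪ {ω | n / 4 ≤ W ω ^ 2}) ∪
        {ω | ε / 2 ≤ δ * W ω ^ 2 + p ω / δ}) ∪ {ω | (ε / 2) ^ 2 ≤ D ω ^ 2} : Set Ω) := by
    filter_upwards [hT] with ω hω hbad
    by_contra hgood
    change ¬ ((((1 / 2 ≤ p ω) ∨ n / 4 ≤ W ω ^ 2) ∨ ε / 2 ≤ δ * W ω ^ 2 + p ω / δ) ∨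
      (ε / 2) ^ 2 ≤ D ω ^ 2) at hgood
    change ε ≤ _ at hbad
    push Not at hgood
    obtain ⟨⟨⟨h1, h2⟩, h3⟩, h4⟩ := hgood
    -- From here on `ω` lies outside the four exceptional events, and `hbad` is to be contradicted.
    have hGc : (n : ℝ)⁻¹ * ∑ i ∈ Finset.range n, huberScore α (x i ω - c)
        = (√(n : ℝ))⁻¹ * W ω := by
      rw [hW, ← mul_assoc, ← mul_inv, ← sq, hsq2]
    have hVD : (√(n : ℝ))⁻¹ * (∑ i ∈ Finset.range n, x i ω - n * μ) = W ω - D ω := by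
      simp only [hW, hD, Finset.sum_sub_distrib, Finset.sum_const, Finset.card_range,
        nsmul_eq_mul]
      ring
    have hWabs : |(√(n : ℝ))⁻¹ * W ω| < 1 / 2 := by
      rw [abs_mul, abs_of_pos (inv_pos.2 hsq), inv_mul_lt_iff₀ hsq]
      refine abs_lt_of_sq_lt_sq ?_ (by positivity)
      have e : (√(n : ℝ) * (1 / 2)) ^ 2 = n / 4 := by rw [mul_pow, hsq2]; ring
      rwa [e]
    have key := (nearUnitSlope_average hα c hn fun i => x i ω).abs_zero_sub_le
      (z := T ω) (hp0 ω) h1.le (by rwa [hGc]) (by simp [hω])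
    simp only [hGc] at key
    change _ ≤ 2 * p ω * _ at key
    have key2 : |√(n : ℝ) * (T ω - c) - W ω| ≤ 2 * p ω * |W ω| := by
      have e1 : √(n : ℝ) * (T ω - c) - W ω = √(n : ℝ) * (T ω - c - (√(n : ℝ))⁻¹ * W ω) := by
        field_simp
      rw [e1, abs_mul, abs_of_pos hsq]
      refine (mul_le_mul_of_nonneg_left key hsq.le).trans_eq ?_
      rw [abs_mul, abs_of_pos (inv_pos.2 hsq)]
      field_simp
    -- The arithmetic-geometric mean inequality, with `p ω ^ 2 ≤ p ω`, turns the product into terms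
    -- of known expectation.
    have amgm : 2 * p ω * |W ω| ≤ δ * W ω ^ 2 + p ω / δ := by
      have e : δ * W ω ^ 2 + p ω / δ - 2 * p ω * |W ω|
          = (δ * |W ω| - p ω) ^ 2 / δ + p ω * (1 - p ω) / δ := by
        rw [← sq_abs (W ω)]
        field_simp
        ring
      have : 0 ≤ (δ * |W ω| - p ω) ^ 2 / δ + p ω * (1 - p ω) / δ :=
        add_nonneg (by positivity)
          (div_nonneg (mul_nonneg (hp0 ω) (by linarith)) hδ.le)
      linarith
    have hDabs : |D ω| < ε / 2 := abs_lt_of_sq_lt_sq h4 (by positivity)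
    rw [hVD] at hbad
    have := abs_add_le (√(n : ℝ) * (T ω - c) - W ω) (D ω)
    rw [show √(n : ℝ) * (T ω - c) - W ω + D ω = √(n : ℝ) * (T ω - c) - (W ω - D ω) by ring] at this
    linarith
  refine (ENNReal.toReal_mono (measure_ne_top _ _) (measure_mono_ae hsub)).trans ?_
  refine (measureReal_union_le _ _).trans (add_le_add ((measureReal_union_le _ _).trans
    (add_le_add ((measureReal_union_le _ _).trans (add_le_add ?_ ?_)) ?_)) ?_)
  · refine (measureReal_ge_le_integral_div hpI hp0 (by norm_num)).trans ?_
    rw [hpE]; linarith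
  · refine (measureReal_ge_le_integral_div hWI (fun _ => sq_nonneg _) (by positivity)).trans ?_
    rw [div_le_div_iff₀ (by positivity) hnR]
    nlinarith
  · refine (measureReal_ge_le_integral_div ((hWI.const_mul δ).add (hpI.div_const δ))
      (fun ω => add_nonneg (by positivity) (div_nonneg (hp0 ω) hδ.le)) (by positivity)).trans ?_
    simp only [Pi.add_apply]
    rw [integral_add (hWI.const_mul δ) (hpI.div_const δ), integral_const_mul, integral_div, hpE]
    have : F.real {y | α - 1 < |y - c|} / δ ≤ δ := by
      rw [div_le_iff₀ hδ]; linarith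
    rw [div_le_div_iff₀ (by positivity) hε]
    nlinarith [mul_le_mul_of_nonneg_left hWE hδ.le]
  · refine (measureReal_ge_le_integral_div hDI (fun _ => sq_nonneg _) (by positivity)).trans ?_
    rw [hDE, div_le_div_iff₀ (by positivity) (by positivity)]
    exact le_of_eq (by ring)

end Sample

/-! ### Limits of population quantities -/

section Limits

variable {F : Measure ℝ} [IsProbabilityMeasure F] {μ : ℝ} {α t : ℕ → ℝ}

theorem tendsto_measureReal_lt_abs_sub (hF : MemLp (fun y : ℝ => y) 2 F)
    (hα : Tendsto α atTop atTop) (ht : ∀ᶠ n in atTop, |t n - μ| ≤ 1) :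
    Tendsto (fun n => F.real {y | α n - 1 < |y - t n|}) atTop (𝓝 0) := by
  have hI : Integrable (fun y : ℝ => |y - μ|) F :=
    ((hF.sub (memLp_const μ)).integrable one_le_two).abs
  have hlim : Tendsto (fun n => (∫ y, |y - μ| ∂F) / (α n - 2)) atTop (𝓝 0) :=
    (tendsto_atTop_add_const_right _ (-2) hα).const_div_atTop _
  refine squeeze_zero' (.of_forall fun n => measureReal_nonneg) ?_ hlim
  filter_upwards [ht, hα.eventually_gt_atTop 2] with n htn hn
  refine (measureReal_mono fun y hy => ?_).trans
    (measureReal_ge_le_integral_div hI (fun _ => abs_nonneg _) (sub_pos.2 hn))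
  change α n - 1 < _ at hy
  have := abs_sub_le y μ (t n)
  rw [abs_sub_comm μ] at this
  change α n - 2 ≤ |y - μ|
  linarith

theorem eventually_huberScore_eq (hα : Tendsto α atTop atTop) (ht : Tendsto t atTop (𝓝 μ))
    (y : ℝ) : ∀ᶠ n in atTop, huberScore (α n) (y - t n) = y - t n := by
  have h1 : Tendsto (fun n => |y - t n|) atTop (𝓝 |y - μ|) := (ht.const_sub y).abs
  filter_upwards [h1.eventually_le_const (lt_add_one _), hα.eventually_ge_atTop (|y - μ| + 1),
    hα.eventually_gt_atTop 0] with n h2 h3 h4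
  exact huberScore_of_abs_le h4 (h2.trans h3)

theorem tendsto_expectedScore (hF : MemLp (fun y : ℝ => y) 2 F) (hμ : ∫ y, y ∂F = μ)
    (hα : Tendsto α atTop atTop) : Tendsto (fun n => expectedScore F (α n) μ) atTop (𝓝 0) := by
  have hi := hF.integrable one_le_two
  have h0 : ∫ y, (y - μ) ∂F = 0 := by
    rw [integral_sub hi (integrable_const μ), hμ]; simp
  rw [← h0]
  refine tendsto_integral_filter_of_dominated_convergence (fun y => |y - μ|)
    (.of_forall fun n => ?_) ?_ (hi.sub (integrable_const μ)).abs (.of_forall fun y => ?_)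
  · exact (measurable_huberScore_sub (α n) μ).aestronglyMeasurable
  · filter_upwards [hα.eventually_gt_atTop 0] with n hn
    exact .of_forall fun y => abs_huberScore_le_abs hn _
  · refine tendsto_const_nhds.congr' ?_
    filter_upwards [eventually_huberScore_eq hα (tendsto_const_nhds (x := μ)) y] with n hn
    exact hn.symm

theorem tendsto_integral_huberScore_sub_sq (hF : MemLp (fun y : ℝ => y) 2 F)
    (hα : Tendsto α atTop atTop) (ht : Tendsto t atTop (𝓝 μ)) :
    Tendsto (fun n => ∫ y, (huberScore (α n) (y - t n) - (y - μ)) ^ 2 ∂F) atTop (𝓝 0) := by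
  have hL : MemLp (fun y : ℝ => 2 * |y - μ| + 1) 2 F :=
    ((hF.sub (memLp_const μ)).abs.const_mul 2).add (memLp_const 1)
  have h0 : ∫ _, (0 : ℝ) ∂F = 0 := by simp
  rw [← h0]
  refine tendsto_integral_filter_of_dominated_convergence (fun y => (2 * |y - μ| + 1) ^ 2)
    (.of_forall fun n => ?_) ?_ hL.integrable_sq (.of_forall fun y => ?_)
  · have := measurable_huberScore_sub (α n) (t n)
    fun_prop
  · have h1 : Tendsto (fun n => |t n - μ|) atTop (𝓝 0) := by
      simpa using (ht.sub_const μ).abs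
    filter_upwards [hα.eventually_gt_atTop 0, h1.eventually_le_const one_pos] with n hn hn1
    refine .of_forall fun y => ?_
    rw [Real.norm_eq_abs, abs_of_nonneg (sq_nonneg _), ← sq_abs]
    gcongr
    have e1 := abs_sub (huberScore (α n) (y - t n)) (y - μ)
    have e2 := abs_huberScore_le_abs hn (y - t n)
    have e3 := abs_sub_le y μ (t n)
    rw [abs_sub_comm μ] at e3
    linarith
  · have h2 : Tendsto (fun n => (μ - t n) ^ 2) atTop (𝓝 0) := by
      simpa using (ht.const_sub μ).pow 2
    refine h2.congr' ?_
    filter_upwards [eventually_huberScore_eq hα ht y] with n hn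
    rw [hn]; ring

end Limits

theorem theorem3p2
    {Ω : Type*} [MeasurableSpace Ω] (P : Measure Ω) [IsProbabilityMeasure P]
    -- the distribution `F`, with mean `μ` and finite variance `σ2`
    (F : Measure ℝ) [IsProbabilityMeasure F] (μ : ℝ) (σ2 : ℝ≥0)
    (hF : MemLp (fun y : ℝ => y) 2 F)
    (hμ : ∫ y, y ∂F = μ)
    (hσ : ∫ y, (y - μ) ^ 2 ∂F = (σ2 : ℝ))
    -- an i.i.d. sample from `F` (the `n`-th sample is `x 0, …, x (n - 1)`)
    (x : ℕ → Ω → ℝ) (hlaw : ∀ i, HasLaw (x i) F P) (hindep : iIndepFun x P)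
    -- the diverging parameter
    (α : ℕ → ℝ) (hα : Tendsto α atTop atTop) :
    -- for large `n`, the expected score has exactly one zero
    (∀ᶠ n in atTop, ∃! s : ℝ, expectedScore F (α n) s = 0) ∧
    ∀ t : ℕ → ℝ, (∀ᶠ n in atTop, expectedScore F (α n) (t n) = 0) →
      -- asymptotic normality of every M-estimator
      (∀ T : ℕ → Ω → ℝ, (∀ n, AEMeasurable (T n) P) →
        (∀ᶠ n in atTop, ∀ᵐ ω ∂P,
          ∑ i ∈ Finset.range n, huberScore (α n) (x i ω - T n ω) = 0) →
        TendstoInDistribution (fun (n : ℕ) ω => √(n : ℝ) * (T n ω - t n)) atTop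
          (fun y : ℝ => y) (fun _ => P) (gaussianReal 0 σ2)) ∧
      -- the bias: the ratio tends to `1` along the `n` where it is defined,
      -- and for the other large `n` numerator and denominator both vanish
      Tendsto (fun n => (t n - μ) / expectedScore F (α n) μ)
        (atTop ⊓ 𝓟 {n | expectedScore F (α n) μ ≠ 0}) (𝓝 1) ∧
      (∀ᶠ n in atTop, expectedScore F (α n) μ = 0 → t n = μ) := by

  have hα0 : ∀ᶠ n in atTop, 0 < α n := hα.eventually_gt_atTop 0
  have hlam : Tendsto (fun n => expectedScore F (α n) μ) atTop (𝓝 0) :=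
    tendsto_expectedScore hF hμ hα
  have hlam' : ∀ᶠ n in atTop, |expectedScore F (α n) μ| < 1 / 2 := by
    have := hlam.abs
    rw [abs_zero] at this
    exact this.eventually_lt_const (by norm_num)
  have hp : Tendsto (fun n => F.real {y | α n - 1 < |y - μ|}) atTop (𝓝 0) :=
    tendsto_measureReal_lt_abs_sub (t := fun _ => μ) (μ := μ) hF hα (by simp)
  have hp' : ∀ᶠ n in atTop, F.real {y | α n - 1 < |y - μ|} ≤ 1 / 2 :=
    hp.eventually_le_const (by norm_num)
  refine ⟨?_, fun t ht => ?_⟩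
  · filter_upwards [hα0, hlam', hp'] with n h1 h2 h3
    exact (nearUnitSlope_expectedScore h1 μ).existsUnique_zero h3 h2
  have hbias : ∀ᶠ n in atTop, |t n - μ - expectedScore F (α n) μ|
      ≤ 2 * F.real {y | α n - 1 < |y - μ|} * |expectedScore F (α n) μ| := by
    filter_upwards [hα0, hlam', hp', ht] with n h1 h2 h3 h4
    exact (nearUnitSlope_expectedScore h1 μ).abs_zero_sub_le measureReal_nonneg h3 h2 h4
  have htμ : Tendsto t atTop (𝓝 μ) := by
    have h1 : Tendsto (fun n => t n - μ - expectedScore F (α n) μ) atTop (𝓝 0) :=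
      squeeze_zero_norm' hbias (by simpa using (hp.const_mul 2).mul hlam.abs)
    simpa using (h1.add hlam).add_const μ
  refine ⟨fun T hTm hT => ?_, ?_, ?_⟩
  · have ht1 : ∀ᶠ n in atTop, |t n - μ| ≤ 1 := by
      have : Tendsto (fun n => |t n - μ|) atTop (𝓝 0) := by simpa using (htμ.sub_const μ).abs
      exact this.eventually_le_const one_pos
    have hident i : IdentDistrib (x i) (x 0) P P :=
      ⟨(hlaw i).aemeasurable, (hlaw 0).aemeasurable, by rw [(hlaw i).map_eq, (hlaw 0).map_eq]⟩
    have hmean : P[x 0] = μ := (hlaw 0).integral_eq.trans hμ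
    have hvar : Var[x 0; P] = (σ2 : ℝ) := by
      rw [(hlaw 0).variance_eq, variance_eq_integral aemeasurable_id, ← hσ]
      simp [hμ]
    have hclt := tendstoInDistribution_inv_sqrt_mul_sum_sub (P := P) (X := x)
      (P' := gaussianReal 0 σ2) (Y := fun y : ℝ => y)
      (by rw [hvar, Real.toNNReal_coe]; exact HasLaw.id)
      (memLp_comp_of_hasLaw (hlaw 0) hF) hindep hident
    rw [hmean] at hclt
    refine tendstoInDistribution_of_tendstoInMeasure_sub _ _ hclt ?_
      fun n => ((hTm n).sub_const _).const_mul _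
    rw [tendstoInMeasure_iff_measureReal_norm]
    intro ε hε
    simp only [Pi.sub_apply, Pi.zero_apply, sub_zero, Real.norm_eq_abs]
    have hq := tendsto_measureReal_lt_abs_sub hF hα ht1
    set q : ℕ → ℝ := fun n => F.real {y | α n - 1 < |y - t n|}
    have hinv : Tendsto (fun n : ℕ => 1 / (n : ℝ)) atTop (𝓝 0) :=
      tendsto_one_div_atTop_nhds_zero_nat
    -- The summand `1 / n` keeps `δ n` positive even when `q n = 0`.
    set δ : ℕ → ℝ := fun n => √(q n + 1 / n) with hδdef
    have hδ : Tendsto δ atTop (𝓝 0) := by simpa [hδdef] using (hq.add hinv).sqrt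
    -- `|ψ (y - t n)| ≤ |y - t n| ≤ |y - μ| + 1`, so `M` bounds the second moments of the scores.
    set M : ℝ := ∫ y, (|y - μ| + 1) ^ 2 ∂F
    have hML : MemLp (fun y : ℝ => |y - μ| + 1) 2 F :=
      (hF.sub (memLp_const μ)).abs.add (memLp_const 1)
    have hd := tendsto_integral_huberScore_sub_sq hF hα htμ
    have hlim : Tendsto (fun n : ℕ => 2 * δ n ^ 2 + 4 * M / n + 2 * δ n * (M + 1) / ε
        + 4 * (∫ y, (huberScore (α n) (y - t n) - (y - μ)) ^ 2 ∂F) / ε ^ 2) atTop (𝓝 0) := by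
      have h1 := ((hδ.pow 2).const_mul 2).add (hinv.const_mul (4 * M))
      have h2 := (h1.add (((hδ.const_mul 2).mul_const (M + 1)).div_const ε)).add
        ((hd.const_mul 4).div_const (ε ^ 2))
      simpa [div_eq_mul_inv] using h2
    refine squeeze_zero' (.of_forall fun n => measureReal_nonneg) ?_ hlim
    filter_upwards [hα0, ht, ht1, hT, eventually_gt_atTop 0] with n h1 h2 h3 h4 hn
    have hqn : 0 ≤ q n := measureReal_nonneg
    have hnR : (0 : ℝ) < 1 / n := by positivity
    refine measureReal_mestimator_sub_le hF hμ hlaw hindep h1 h2 ?_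
      (Real.sqrt_pos.2 (by linarith)) ?_ hε hn h4
    · refine integral_mono_of_nonneg (.of_forall fun y => sq_nonneg _) hML.integrable_sq
        (.of_forall fun y => ?_)
      dsimp only
      rw [← sq_abs]
      gcongr
      have e2 := abs_huberScore_le_abs h1 (y - t n)
      have e3 := abs_sub_le y μ (t n)
      rw [abs_sub_comm μ] at e3
      linarith
    · change q n ≤ δ n ^ 2
      rw [hδdef, Real.sq_sqrt (by linarith)]
      linarith
  · rw [tendsto_iff_norm_sub_tendsto_zero]
    have h2p : Tendsto (fun n => 2 * F.real {y | α n - 1 < |y - μ|})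
        (atTop ⊓ 𝓟 {n | expectedScore F (α n) μ ≠ 0}) (𝓝 0) := by
      simpa using (hp.const_mul 2).mono_left inf_le_left
    refine squeeze_zero' (.of_forall fun n => norm_nonneg _) ?_ h2p
    rw [eventually_inf_principal]
    filter_upwards [hbias] with n hn hne
    change expectedScore F (α n) μ ≠ 0 at hne
    rw [div_sub_one hne, norm_div, Real.norm_eq_abs, Real.norm_eq_abs,
      div_le_iff₀ (abs_pos.2 hne)]
    exact hn
  · filter_upwards [hbias] with n hn h0
    rw [h0] at hn
    simpa [sub_eq_zero] using hn
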